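/- For $x\in\mathbb{R}$ let \[ \tilde U_{-1}(x)=\begin{cases}0,&|x|\le 1,\\ -\dfrac{\operatorname{sgn}(x)}{\sqrt{x^2-1}},&|x|>1,\end{cases}\qquad \tilde U_{-2}(x)=\begin{cases}0,&|x|\le 1,\\ -\dfrac{|x|}{\sqrt{x^2-1}},&|x|>1,\end{cases}\qquad \tilde U_0(x)=\tilde T_0(x)+\tilde U_{-2}(x), \] where $\tilde T_n(x)=T_n(x)$ (the Chebyshev polynomial of the first kind) for $|x|\le1$ and $\tilde T_n(x)=(x-\operatorname{sgn}(x)\sqrt{x^2-1})^n$ for $|x|>1$; in particular $\tilde T_0\equiv 1$. Let \[ J_n(x)=\sum_{k=0}^\infty\frac{(-1)^k}{k!\,(k+n)!}\Big(\frac x2\Big)^{2k+n} \] denote the Bessel functions of the first kind. The Fourier transform is $\mathcal F[f](\omega)=\int_{\mathbb R}f(x)e^{-i\omega x}\,dx$ for $f\in L^1(\mathbb R)$. For tempered distributions, and hence for all $f\in L^p(\mathbb{R})$, it is defined by duality: $\langle\mathcal F[f],\varphi\rangle=\langle f,\mathcal F[\varphi]\rangle$ for all Schwartz functions $\varphi$.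 1. For all $p\in(1,2)$, with $1/p+1/q=1$, one has $\tilde U_{-1}\in L^p(\mathbb R)$, the function $\omega\mapsto i\omega\pi J_0(\omega)/|\omega|$ belongs to $L^q(\mathbb R)$, and, as tempered distributions (equivalently, for almost every $\omega$), \[ \mathcal F[\tilde U_{-1}](\omega)=\frac{i\,\omega\,\pi J_0(\omega)}{|\omega|}. \] 2. $\tilde U_0\in L^1(\mathbb R)$, and for every $\omega\in\mathbb R$ \[ \mathcal F[\tilde U_0](\omega)=\pi J_1(|\omega|)+\frac{2\sin(\omega)}{\omega}-\frac{2\sin(|\omega|)}{|\omega|}, \] where $\sin(t)/t$ is understood as $1$ at $t=0$. -/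

import Mathlib

open MeasureTheory Polynomial
open scoped ENNReal SchwartzMap FourierTransform

noncomputable section

/-- The extended Chebyshev functions of the first kind: `T_n` on `[-1, 1]`, continued to the rest
of the real line by `(x - sgn(x) √(x² - 1)) ^ n`. -/
def extendedT (n : ℕ) (x : ℝ) : ℝ :=
  if |x| ≤ 1 then (Chebyshev.T ℝ n).eval x
  else (x - Real.sign x * Real.sqrt (x ^ 2 - 1)) ^ n

/-- The function `Ũ₋₂`. -/
def extendedUNegTwo (x : ℝ) : ℝ :=
  if |x| ≤ 1 then 0 else -(|x| / Real.sqrt (x ^ 2 - 1))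

/-- The function `Ũ₋₁`. -/
def extendedUNegOne (x : ℝ) : ℝ :=
  if |x| ≤ 1 then 0 else -(Real.sign x / Real.sqrt (x ^ 2 - 1))

/-- The function `Ũ₀ = T̃₀ + Ũ₋₂`. -/
def extendedUZero (x : ℝ) : ℝ :=
  extendedT 0 x + extendedUNegTwo x

/-- The Bessel function of the first kind `J_n` of integer order `n ≥ 0` on the real line,
through its everywhere convergent power series. -/
def besselJ (n : ℕ) (x : ℝ) : ℝ :=
  ∑' k : ℕ, (-1 : ℝ) ^ k / ((k.factorial : ℝ) * ((k + n).factorial : ℝ)) * (x / 2) ^ (2 * k + n)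

/-- The series defining `besselJ` converges (absolutely) at every real point. -/
theorem summable_besselJ (n : ℕ) (x : ℝ) :
    Summable fun k : ℕ =>
      (-1 : ℝ) ^ k / ((k.factorial : ℝ) * ((k + n).factorial : ℝ)) * (x / 2) ^ (2 * k + n) := by
  refine Summable.of_norm_bounded
    (g := fun k : ℕ => |x / 2| ^ n * (((x / 2) ^ 2) ^ k / (k.factorial : ℝ)))
    ((Real.summable_pow_div_factorial _).mul_left _) fun k => ?_
  have h1 : (1 : ℝ) ≤ ((k + n).factorial : ℝ) := by
    exact_mod_cast Nat.one_le_iff_ne_zero.mpr (Nat.factorial_ne_zero _)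
  have h0 : (0 : ℝ) < (k.factorial : ℝ) := by exact_mod_cast Nat.factorial_pos k
  have hx : |x / 2| ^ (2 * k + n) = |x / 2| ^ n * ((x / 2) ^ 2) ^ k := by
    rw [pow_add, pow_mul, sq_abs, mul_comm]
  rw [Real.norm_eq_abs, abs_mul, abs_div, abs_pow, abs_neg, abs_one, one_pow, abs_pow, hx,
    abs_of_pos (mul_pos h0 (by linarith))]
  have hc : 0 ≤ |x / 2| ^ n * ((x / 2) ^ 2) ^ k := by positivity
  have h2 : 1 / ((k.factorial : ℝ) * ((k + n).factorial : ℝ)) ≤ 1 / (k.factorial : ℝ) :=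
    one_div_le_one_div_of_le h0 (by nlinarith)
  calc 1 / ((k.factorial : ℝ) * ((k + n).factorial : ℝ)) * (|x / 2| ^ n * ((x / 2) ^ 2) ^ k)
      ≤ 1 / (k.factorial : ℝ) * (|x / 2| ^ n * ((x / 2) ^ 2) ^ k) :=
        mul_le_mul_of_nonneg_right h2 hc
    _ = |x / 2| ^ n * (((x / 2) ^ 2) ^ k / (k.factorial : ℝ)) := by ring

/-- The Fourier integral `∫ f(x) e^{-iωx} dx` (for `f` integrable), without `2π` in the
exponent. -/
def fourierInt (f : ℝ → ℂ) (ω : ℝ) : ℂ :=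
  ∫ x : ℝ, f x * Complex.exp (-(Complex.I * ω * x))

/-- The dilation `ω ↦ ω / (2π)` of the real line. -/
def scaleTwoPi : ℝ ≃L[ℝ] ℝ :=
  ContinuousLinearEquiv.unitsEquivAut ℝ
    (Units.mk0 ((2 * Real.pi)⁻¹) (inv_ne_zero (mul_ne_zero two_ne_zero Real.pi_ne_zero)))

/-- The Fourier transform `φ ↦ ∫ φ(x) e^{-iωx} dx` as an operator on Schwartz functions,
see `schwartzFourier_apply`. -/
def schwartzFourier : 𝓢(ℝ, ℂ) →L[ℂ] 𝓢(ℝ, ℂ) :=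
  (SchwartzMap.compCLMOfContinuousLinearEquiv ℂ scaleTwoPi).comp
    (FourierTransform.fourierCLM ℂ 𝓢(ℝ, ℂ))

theorem schwartzFourier_apply (φ : 𝓢(ℝ, ℂ)) (ω : ℝ) :
    schwartzFourier φ ω = fourierInt φ ω := by
  have h : schwartzFourier φ ω = 𝓕 (φ : ℝ → ℂ) (ω * (2 * Real.pi)⁻¹) := rfl
  rw [h, Real.fourier_real_eq_integral_exp_smul, fourierInt]
  refine integral_congr_ae (Filter.Eventually.of_forall fun x => ?_)
  have hpi : (Real.pi : ℂ) ≠ 0 := by exact_mod_cast Real.pi_ne_zero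
  simp only [smul_eq_mul]
  rw [mul_comm]
  congr 2
  push_cast
  field_simp

/-- The Fourier transform of tempered distributions, by duality:
`⟨F[u], φ⟩ = ⟨u, F[φ]⟩` for all Schwartz functions `φ`. -/
def temperedFourier : 𝓢'(ℝ, ℂ) →L[ℂ] 𝓢'(ℝ, ℂ) :=
  PointwiseConvergenceCLM.precomp ℂ schwartzFourier

theorem temperedFourier_apply (u : 𝓢'(ℝ, ℂ)) (φ : 𝓢(ℝ, ℂ)) :
    temperedFourier u φ = u (schwartzFourier φ) := rfl

end

/-!
Both formulas say that a Bessel function on the frequency side is the Fourier transform of an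
algebraic function, and both are proved backwards, from the Bessel function to its transform. The
signed function `sgn(ω) J₀(ω)` and the even function `J₁(|ω|)` are bounded, so that after damping by
`e^{-ε|ω|}` their Fourier transforms are classical integrals, namely combinations of the Laplace
transforms of `J₀` and `J₁` at the points `ε ± ix` (`fourierInt_exp_neg_abs_mul`).

The recurrences `J₀' = -J₁` and `(t J₁)' = t J₀` turn into `L₁ = 1 - s L₀` and the differential
equation `(1 + s²) L₀' + s L₀ = 0`, whose solution with `s L₀(s) → 1` at `+∞` is
`L₀(s) = (1 + s²)^{-1/2}` with the principal branch (`laplace_besselJ_zero`). As `ε → 0` the boundary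
values on `|x| < 1` are real and even in `x`, and on `|x| > 1` imaginary and odd. Hence the difference
`L₀(ε + ix) - L₀(ε - ix)` tends to `2i Ũ₋₁(x)`, and `L₁(ε + ix) + L₁(ε - ix)` tends to `2 Ũ₀(x)`.

The convergence is dominated by a multiple of `1 + (1 + |x|) |x² - 1|^{-1/2}`, which is integrable
against Schwartz functions, so the limit passes to the duality pairing, and Fourier inversion on
Schwartz functions gives the two identities of tempered distributions
(`integral_mul_schwartzFourier_neg_of_tendsto`). For `Ũ₀`, which is integrable, both sides are
continuous and the identity holds at every point (`fourierInt_eq_of_forall_schwartz`); the two sinc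
terms cancel, as sinc is even.

Membership in `L^p` follows from the inverse square root singularities at `±1` and the decay at
infinity. Membership of `J₀` in `L^q` for `q > 2` uses the decay `J₀(t) = O(t^{-1/2})`, an energy
estimate for Bessel's equation (`exists_one_add_abs_mul_besselJ_zero_sq_le`).
-/

open Filter Topology

/-! ### Bessel functions of orders zero and one -/

theorem continuous_besselJ (n : ℕ) : Continuous (besselJ n) := by
  refine continuous_iff_continuousAt.mpr fun x => ?_
  have h : ContinuousOn (besselJ n) (Metric.ball 0 (|x| + 1)) := by
    refine continuousOn_tsum (fun k => by fun_prop) (summable_besselJ n (|x| + 1)).norm ?_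
    intro k y hy
    rw [norm_mul, norm_mul]
    refine mul_le_mul_of_nonneg_left ?_ (norm_nonneg _)
    rw [norm_pow, norm_pow, norm_div, norm_div]
    rw [mem_ball_zero_iff] at hy
    gcongr
    exact hy.le.trans (le_abs_self _)
  exact h.continuousAt (Metric.isOpen_ball.mem_nhds (by simp))

theorem besselJ_zero_neg (x : ℝ) : besselJ 0 (-x) = besselJ 0 x := by
  unfold besselJ
  congr 1
  ext k
  simp only [add_zero, neg_div, (even_two_mul k).neg_pow]

theorem besselJ_zero_zero : besselJ 0 0 = 1 := by
  unfold besselJ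
  rw [tsum_eq_single 0 (fun k hk => by simp [hk])]
  simp

theorem besselJ_one_zero : besselJ 1 0 = 0 := by
  simp [besselJ]

theorem hasDerivAt_besselJ_zero (x : ℝ) : HasDerivAt (besselJ 0) (-besselJ 1 x) x := by
  let c : ℕ → ℝ := fun k => (-1 : ℝ) ^ k / ((k.factorial : ℝ) * ((k + 0).factorial : ℝ))
  -- the differentiated series; its term of index `0` vanishes and the others are those of `-J₁`
  let g' : ℕ → ℝ → ℝ := fun k y => c k * (((2 * k + 0 : ℕ) : ℝ) * (y / 2) ^ (2 * k + 0 - 1) * (1 / 2))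
  have hs : ∀ (k : ℕ) (y : ℝ), g' (k + 1) y =
      -((-1 : ℝ) ^ k / ((k.factorial : ℝ) * ((k + 1).factorial : ℝ)) * (y / 2) ^ (2 * k + 1)) := by
    intro k y
    have h0 : (k.factorial : ℝ) ≠ 0 := by positivity
    have h1 : (k : ℝ) + 1 ≠ 0 := by positivity
    simp only [g', c, add_zero, Nat.factorial_succ, show 2 * (k + 1) - 1 = 2 * k + 1 by omega]
    push_cast
    field_simp
    ring
  have hsum : ∀ y, Summable fun k => g' k y := fun y => by
    refine (summable_nat_add_iff 1).mp ?_
    simp only [hs]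
    exact (summable_besselJ 1 y).neg
  have key := hasDerivAt_tsum_of_isPreconnected (𝕜 := ℝ)
    (g := fun k y => c k * (y / 2) ^ (2 * k + 0)) (g' := g') (t := Metric.ball 0 (|x| + 1))
    (y₀ := 0) (y := x) (hsum (|x| + 1)).norm Metric.isOpen_ball
    (convex_ball _ _).isPreconnected
    (fun k y _ => (((hasDerivAt_id y).div_const 2).pow (2 * k + 0)).const_mul (c k))
    (fun k y hy => by
      simp only [g', norm_mul, norm_pow, norm_div]
      rw [mem_ball_zero_iff] at hy
      gcongr
      exact hy.le.trans (le_abs_self _))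
    (by simp; positivity) (summable_besselJ 0 0) (by simp)
  refine key.congr_deriv ?_
  rw [(hsum x).tsum_eq_zero_add]
  simp only [hs, tsum_neg]
  simp [g', besselJ]

theorem hasDerivAt_mul_besselJ_one (x : ℝ) :
    HasDerivAt (fun t => t * besselJ 1 t) (x * besselJ 0 x) x := by
  let c : ℕ → ℝ := fun k => (-1 : ℝ) ^ k / ((k.factorial : ℝ) * ((k + 1).factorial : ℝ))
  let g' : ℕ → ℝ → ℝ := fun k y => y * ((-1 : ℝ) ^ k / ((k.factorial : ℝ) * ((k + 0).factorial : ℝ))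
    * (y / 2) ^ (2 * k + 0))
  have key := hasDerivAt_tsum_of_isPreconnected (𝕜 := ℝ)
    (g := fun k y => y * (c k * (y / 2) ^ (2 * k + 1))) (g' := g') (t := Metric.ball 0 (|x| + 1))
    (y₀ := 0) (y := x) ((summable_besselJ 0 (|x| + 1)).mul_left (|x| + 1)).norm Metric.isOpen_ball
    (convex_ball _ _).isPreconnected
    (fun k y _ => by
      have h := (hasDerivAt_id y).mul
        ((((hasDerivAt_id y).div_const 2).pow (2 * k + 1)).const_mul (c k))
      refine h.congr_deriv ?_
      have h0 : (k.factorial : ℝ) ≠ 0 := by positivity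
      have h1 : (k : ℝ) + 1 ≠ 0 := by positivity
      simp only [g', c, id, add_zero, Nat.factorial_succ, Nat.add_sub_cancel, Pi.pow_apply]
      push_cast
      field_simp
      ring)
    (fun k y hy => by
      simp only [g', norm_mul, norm_pow, norm_div]
      rw [mem_ball_zero_iff] at hy
      have : ‖y‖ ≤ ‖|x| + 1‖ := hy.le.trans (le_abs_self _)
      gcongr)
    (by simp; positivity) (by simp) (by simp)
  simpa only [g', c, tsum_mul_left, besselJ] using key

theorem hasDerivAt_besselJ_one {x : ℝ} (hx : x ≠ 0) :
    HasDerivAt (besselJ 1) (besselJ 0 x - besselJ 1 x / x) x := by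
  have h := (hasDerivAt_mul_besselJ_one x).div (hasDerivAt_id x) hx
  refine (h.congr_of_eventuallyEq ?_).congr_deriv ?_
  · filter_upwards [eventually_ne_nhds hx] with t ht
    simp [ht]
  · simp only [id]
    field_simp

/-- The derivative of `J₀² + J₁²` at `t > 0` is `-2 J₁² / t ≤ 0`, and the value at `0` is `1`. -/
theorem besselJ_sq_add_sq_le {t : ℝ} (ht : 0 ≤ t) : besselJ 0 t ^ 2 + besselJ 1 t ^ 2 ≤ 1 := by
  have hd : ∀ x ∈ interior (Set.Ici (0 : ℝ)),
      HasDerivAt (fun t => besselJ 0 t ^ 2 + besselJ 1 t ^ 2) (-(2 * besselJ 1 x ^ 2 / x)) x := by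
    intro x hx
    rw [interior_Ici] at hx
    have hx0 : x ≠ 0 := ne_of_gt hx
    refine (((hasDerivAt_besselJ_zero x).pow 2).add
      ((hasDerivAt_besselJ_one hx0).pow 2)).congr_deriv ?_
    field_simp
    ring
  have h := antitoneOn_of_deriv_nonpos (convex_Ici (0 : ℝ))
    (((continuous_besselJ 0).pow 2).add ((continuous_besselJ 1).pow 2)).continuousOn
    (fun x hx => (hd x hx).differentiableAt.differentiableWithinAt)
    (fun x hx => by
      rw [interior_Ici] at hx
      have hx' : 0 < x := hx
      have := (hd x (by rwa [interior_Ici])).deriv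
      refine this.trans_le ?_
      have : 0 ≤ 2 * besselJ 1 x ^ 2 / x := by positivity
      linarith)
  have := h Set.self_mem_Ici ht ht
  simpa [besselJ_zero_zero, besselJ_one_zero] using this

theorem abs_besselJ_zero_le {t : ℝ} (ht : 0 ≤ t) : |besselJ 0 t| ≤ 1 :=
  abs_le_one_iff_mul_self_le_one.mpr (by nlinarith [besselJ_sq_add_sq_le ht, sq_nonneg (besselJ 1 t)])

theorem abs_besselJ_one_le {t : ℝ} (ht : 0 ≤ t) : |besselJ 1 t| ≤ 1 :=
  abs_le_one_iff_mul_self_le_one.mpr (by nlinarith [besselJ_sq_add_sq_le ht, sq_nonneg (besselJ 0 t)])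

/-- The decay `J₀(t) = O(t^{-1/2})`. The function `u(t) = √t J₀(t)` solves
`u'' + (1 + 1/(4t²)) u = 0`, so that its energy `u'² + (1 + 1/(4t²)) u²` is decreasing; in terms of
`J₀` and `J₁` the energy is `t (J₀² + J₁²) - J₀ J₁ + J₀² / (2t)`. -/
theorem exists_one_add_abs_mul_besselJ_zero_sq_le :
    ∃ C : ℝ, ∀ t : ℝ, (1 + |t|) * besselJ 0 t ^ 2 ≤ C := by
  let E : ℝ → ℝ := fun t => t * (besselJ 0 t ^ 2 + besselJ 1 t ^ 2) - besselJ 0 t * besselJ 1 t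
    + besselJ 0 t ^ 2 / (2 * t)
  have hd : ∀ x : ℝ, 0 < x → HasDerivAt E (-(besselJ 0 x ^ 2 / (2 * x ^ 2))) x := by
    intro x hx
    have hx0 : x ≠ 0 := hx.ne'
    have h0 := hasDerivAt_besselJ_zero x
    have h1 := hasDerivAt_besselJ_one hx0
    have h := (((hasDerivAt_id x).mul ((h0.pow 2).add (h1.pow 2))).sub (h0.mul h1)).add
      ((h0.pow 2).div ((hasDerivAt_id x).const_mul 2) (by simpa using hx0))
    refine h.congr_deriv ?_
    simp only [id, Pi.add_apply, Pi.pow_apply]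
    field_simp
    ring
  have hanti : AntitoneOn E (Set.Ici 1) := by
    refine antitoneOn_of_deriv_nonpos (convex_Ici (1 : ℝ))
      (fun x hx => (hd x (zero_lt_one.trans_le hx)).continuousAt.continuousWithinAt)
      (fun x hx => ?_) (fun x hx => ?_)
    all_goals
      rw [interior_Ici] at hx
      have hx' : 0 < x := zero_lt_one.trans hx
    · exact (hd x hx').differentiableAt.differentiableWithinAt
    · rw [(hd x hx').deriv]
      have : 0 ≤ besselJ 0 x ^ 2 / (2 * x ^ 2) := by positivity
      linarith
  have hpos : ∀ t : ℝ, 0 ≤ t → (1 + t) * besselJ 0 t ^ 2 ≤ 2 + |E 1| := by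
    intro t ht
    have hb := abs_le.mp (abs_besselJ_zero_le ht)
    have hsq : besselJ 0 t ^ 2 ≤ 1 := by nlinarith
    rcases le_total t 1 with h1 | h1
    · nlinarith [abs_nonneg (E 1), sq_nonneg (besselJ 0 t)]
    · have hE := hanti Set.self_mem_Ici h1 h1
      have ht0 : 0 < t := zero_lt_one.trans_le h1
      -- completing the square, `E t - t J₀² = t (J₁ - J₀ / (2t))² + J₀² / (4t)`
      have hEt : t * besselJ 0 t ^ 2 ≤ E t := by
        have : E t = t * besselJ 0 t ^ 2 + (t * (besselJ 1 t - besselJ 0 t / (2 * t)) ^ 2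
            + besselJ 0 t ^ 2 / (4 * t)) := by
          simp only [E]
          field_simp
          ring
        have h2 : 0 ≤ t * (besselJ 1 t - besselJ 0 t / (2 * t)) ^ 2
            + besselJ 0 t ^ 2 / (4 * t) := by positivity
        linarith
      linarith [le_abs_self (E 1)]
  refine ⟨2 + |E 1|, fun t => ?_⟩
  have h := hpos |t| (abs_nonneg t)
  rcases abs_choice t with h' | h'
  · rw [h'] at h ⊢
    exact h
  · rw [h', besselJ_zero_neg] at h
    rwa [h']

/-! ### Laplace transforms of the Bessel functions -/


/-- The Laplace transform `s ↦ ∫₀^∞ f(t) e^{-st} dt` of a real function. -/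
noncomputable def laplace (f : ℝ → ℝ) (s : ℂ) : ℂ :=
  ∫ t in Set.Ioi (0 : ℝ), (f t : ℂ) * Complex.exp (-(s * t))

theorem norm_mul_exp_neg_mul_le {f : ℝ → ℝ} (hb : ∀ t, 0 ≤ t → |f t| ≤ 1) (s : ℂ) {t : ℝ} (ht : 0 ≤ t) :
    ‖(f t : ℂ) * Complex.exp (-(s * t))‖ ≤ Real.exp (-s.re * t) := by
  rw [norm_mul, Complex.norm_exp, Complex.norm_real, Real.norm_eq_abs]
  have : (-(s * t)).re = -s.re * t := by simp
  rw [this]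
  exact mul_le_of_le_one_left (Real.exp_pos _).le (hb t ht)

theorem integrableOn_mul_exp {f : ℝ → ℝ} (hf : Continuous f) (hb : ∀ t, 0 ≤ t → |f t| ≤ 1) {s : ℂ}
    (hs : 0 < s.re) :
    IntegrableOn (fun t : ℝ => (f t : ℂ) * Complex.exp (-(s * t))) (Set.Ioi 0) := by
  refine Integrable.mono' (exp_neg_integrableOn_Ioi 0 hs) (by fun_prop) ?_
  exact (ae_restrict_iff' measurableSet_Ioi).mpr
    (Eventually.of_forall fun t ht => norm_mul_exp_neg_mul_le hb s (le_of_lt ht))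

theorem norm_laplace_le {f : ℝ → ℝ} (hb : ∀ t, 0 ≤ t → |f t| ≤ 1) {s : ℂ} (hs : 0 < s.re) :
    ‖laplace f s‖ ≤ 1 / s.re := by
  have h := norm_integral_le_of_norm_le (exp_neg_integrableOn_Ioi 0 hs)
    ((ae_restrict_iff' measurableSet_Ioi).mpr
      (Eventually.of_forall fun t ht => norm_mul_exp_neg_mul_le hb s (le_of_lt ht)))
  refine h.trans_eq ?_
  rw [integral_exp_mul_Ioi (by linarith) 0]
  simp

theorem conj_laplace (f : ℝ → ℝ) (s : ℂ) :
    (starRingEnd ℂ) (laplace f s) = laplace f ((starRingEnd ℂ) s) := by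
  unfold laplace
  rw [← integral_conj]
  simp [← Complex.exp_conj]

theorem integrableOn_id_mul_exp {b : ℝ} (hb : 0 < b) :
    IntegrableOn (fun t : ℝ => t * Real.exp (-b * t)) (Set.Ioi 0) := by
  simpa using integrableOn_rpow_mul_exp_neg_mul_rpow (p := 1) (s := 1) (by norm_num) one_pos hb

theorem hasDerivAt_laplace {f : ℝ → ℝ} (hf : Continuous f) (hb : ∀ t, 0 ≤ t → |f t| ≤ 1) {s : ℂ}
    (hs : 0 < s.re) :
    IntegrableOn (fun t : ℝ => ((t * f t : ℝ) : ℂ) * Complex.exp (-(s * t))) (Set.Ioi 0) ∧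
    HasDerivAt (laplace f) (-laplace (fun t => t * f t) s) s := by
  have h := hasDerivAt_integral_of_dominated_loc_of_deriv_le
    (μ := volume.restrict (Set.Ioi (0 : ℝ))) (𝕜 := ℂ)
    (F := fun s t => (f t : ℂ) * Complex.exp (-(s * t)))
    (F' := fun s t => (f t : ℂ) * (Complex.exp (-(s * t)) * -(1 * t)))
    (bound := fun t => t * Real.exp (-(s.re / 2) * t)) (x₀ := s) (s := {z | s.re / 2 < z.re})
    ((isOpen_lt continuous_const Complex.continuous_re).mem_nhds
      (by simp only [Set.mem_ofPred_eq]; linarith))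
    (Eventually.of_forall fun z => by fun_prop)
    (integrableOn_mul_exp hf hb hs) (by fun_prop)
    ((ae_restrict_iff' measurableSet_Ioi).mpr (Eventually.of_forall fun t ht z hz => by
      have ht' : 0 < t := ht
      have hz' : s.re / 2 < z.re := hz
      have h1 := norm_mul_exp_neg_mul_le hb z ht'.le
      rw [← mul_assoc, norm_mul, norm_neg, one_mul, Complex.norm_real, Real.norm_eq_abs,
        abs_of_pos ht', mul_comm]
      refine mul_le_mul_of_nonneg_left (h1.trans (Real.exp_le_exp.mpr ?_)) ht'.le
      nlinarith))
    (integrableOn_id_mul_exp (by linarith))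
    (Eventually.of_forall fun t z _ =>
      ((((hasDerivAt_id z).mul_const (t : ℂ)).neg).cexp).const_mul _)
  have he : ∀ t : ℝ, (f t : ℂ) * (Complex.exp (-(s * t)) * -(1 * t)) =
      -(((t * f t : ℝ) : ℂ) * Complex.exp (-(s * t))) := fun t => by push_cast; ring
  simp only [he, integral_neg] at h
  exact ⟨(integrable_neg_iff (f := fun t : ℝ => ((t * f t : ℝ) : ℂ) * Complex.exp (-(s * t)))).mp h.1,
    h.2⟩

/-- Integration by parts for the Laplace transform. -/
theorem laplace_deriv {f f' : ℝ → ℝ} (hf : ∀ t, HasDerivAt f (f' t) t) {s : ℂ}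
    (hi : IntegrableOn (fun t : ℝ => (f t : ℂ) * Complex.exp (-(s * t))) (Set.Ioi 0))
    (hi' : IntegrableOn (fun t : ℝ => (f' t : ℂ) * Complex.exp (-(s * t))) (Set.Ioi 0))
    (h0 : Tendsto (fun t : ℝ => (f t : ℂ) * Complex.exp (-(s * t))) atTop (𝓝 0)) :
    laplace f' s = s * laplace f s - f 0 := by
  have hd : ∀ t : ℝ, HasDerivAt (fun t : ℝ => (f t : ℂ) * Complex.exp (-(s * t)))
      ((f' t : ℂ) * Complex.exp (-(s * t)) - s * ((f t : ℂ) * Complex.exp (-(s * t)))) t := by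
    intro t
    have h1 := (hf t).ofReal_comp
    have h2 : HasDerivAt (fun t : ℝ => Complex.exp (-(s * t)))
      (Complex.exp (-(s * t)) * -(s * 1)) t :=
    (((hasDerivAt_id (t : ℂ)).const_mul s).neg.cexp).comp_ofReal
    refine (h1.mul h2).congr_deriv ?_
    ring
  have h := integral_Ioi_of_hasDerivAt_of_tendsto (a := 0) (hd 0).continuousAt.continuousWithinAt
    (fun t _ => hd t) (hi'.sub (hi.const_mul s)) h0
  rw [integral_sub hi' (hi.const_mul s), integral_const_mul] at h
  simp only [Complex.ofReal_zero, mul_zero, neg_zero, Complex.exp_zero, mul_one, zero_sub] at h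
  unfold laplace
  linear_combination h

theorem tendsto_pow_mul_mul_exp_atTop {f : ℝ → ℝ} (hb : ∀ t, 0 ≤ t → |f t| ≤ 1) {s : ℂ}
    (hs : 0 < s.re) (n : ℕ) :
    Tendsto (fun t : ℝ => ((t ^ n * f t : ℝ) : ℂ) * Complex.exp (-(s * t))) atTop (𝓝 0) := by
  have h := ((Real.tendsto_pow_mul_exp_neg_atTop_nhds_zero n).comp
    (tendsto_id.const_mul_atTop hs)).const_mul ((s.re ^ n)⁻¹)
  rw [mul_zero] at h
  refine squeeze_zero_norm' ?_ h
  filter_upwards [eventually_ge_atTop 0] with t ht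
  have h1 := norm_mul_exp_neg_mul_le hb s ht
  have h2 : ((t ^ n * f t : ℝ) : ℂ) * Complex.exp (-(s * t)) =
      ((t ^ n : ℝ) : ℂ) * ((f t : ℂ) * Complex.exp (-(s * t))) := by push_cast; ring
  have h3 : ‖((t ^ n : ℝ) : ℂ)‖ = t ^ n := by
    rw [Complex.norm_real, Real.norm_of_nonneg (by positivity)]
  rw [h2, norm_mul, h3]
  refine (mul_le_mul_of_nonneg_left h1 (by positivity)).trans_eq ?_
  have : s.re ^ n ≠ 0 := by positivity
  simp only [Function.comp, id, mul_pow]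
  field_simp

/-- The transform of `J₀' = -J₁`. -/
theorem laplace_besselJ_one {s : ℂ} (hs : 0 < s.re) :
    laplace (besselJ 1) s = 1 - s * laplace (besselJ 0) s := by
  have hi0 := integrableOn_mul_exp (continuous_besselJ 0) (fun t => abs_besselJ_zero_le) hs
  have hi1 := integrableOn_mul_exp (continuous_besselJ 1) (fun t => abs_besselJ_one_le) hs
  have h := laplace_deriv (s := s) hasDerivAt_besselJ_zero hi0
    (by simpa using hi1.neg)
    (by simpa using tendsto_pow_mul_mul_exp_atTop (fun t => abs_besselJ_zero_le) hs 0)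
  have hn : laplace (fun t => -besselJ 1 t) s = -laplace (besselJ 1) s := by
    simp [laplace, integral_neg]
  rw [hn, besselJ_zero_zero, Complex.ofReal_one] at h
  linear_combination -h

/-- The differential equation `(1 + s²) L' + s L = 0` of the Laplace transform `L` of `J₀`: it
combines the transforms of `J₀' = -J₁` and of `(t J₁)' = t J₀`. -/
theorem hasDerivAt_laplace_besselJ_zero {s : ℂ} (hs : 0 < s.re) :
    ∃ D : ℂ, HasDerivAt (laplace (besselJ 0)) D s ∧
      (1 + s ^ 2) * D + s * laplace (besselJ 0) s = 0 := by
  obtain ⟨hi0, hd0⟩ := hasDerivAt_laplace (continuous_besselJ 0) (fun t => abs_besselJ_zero_le) hs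
  obtain ⟨hi1, hd1⟩ := hasDerivAt_laplace (continuous_besselJ 1) (fun t => abs_besselJ_one_le) hs
  refine ⟨_, hd0, ?_⟩
  have h := laplace_deriv (s := s) hasDerivAt_mul_besselJ_one hi1 hi0
    (by simpa using tendsto_pow_mul_mul_exp_atTop (fun t => abs_besselJ_one_le) hs 1)
  have hev : laplace (besselJ 1) =ᶠ[𝓝 s] fun z => 1 - z * laplace (besselJ 0) z := by
    filter_upwards [(isOpen_lt continuous_const Complex.continuous_re).mem_nhds hs] with z hz
    exact laplace_besselJ_one hz
  have h2 := (hd1.congr_of_eventuallyEq hev.symm).unique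
    (((hasDerivAt_id s).mul hd0).const_sub 1)
  simp only [id, zero_mul, Complex.ofReal_zero, sub_zero] at h h2
  linear_combination -h + s * h2

theorem one_add_sq_mem_slitPlane {s : ℂ} (hs : 0 < s.re) : 1 + s ^ 2 ∈ Complex.slitPlane := by
  rw [Complex.mem_slitPlane_iff]
  have hre : (1 + s ^ 2).re = 1 + (s.re ^ 2 - s.im ^ 2) := by
    simp [pow_two]
  have him : (1 + s ^ 2).im = 2 * (s.re * s.im) := by
    simp [pow_two]; ring
  by_cases h : s.im = 0
  · left
    rw [hre, h]
    simp only [ne_eq, OfNat.ofNat_ne_zero, not_false_eq_true, zero_pow, sub_zero]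
    positivity
  · right
    rw [him]
    exact mul_ne_zero two_ne_zero (mul_ne_zero hs.ne' h)

/-- The product `L(s) (1 + s²)^{1/2}` has derivative zero on the half-plane, by the differential
equation of `L`, and the value `1` at `+∞`. The principal branch is holomorphic in `s`, since `1 + s²`
avoids the negative axis. -/
theorem laplace_besselJ_zero {s : ℂ} (hs : 0 < s.re) :
    laplace (besselJ 0) s = (1 + s ^ 2) ^ (((-1 / 2 : ℝ)) : ℂ) := by
  let H : Set ℂ := {z | 0 < z.re}
  let G : ℂ → ℂ := fun z => laplace (besselJ 0) z * (1 + z ^ 2) ^ (1 / 2 : ℂ)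
  have hG : ∀ z ∈ H, HasDerivAt G 0 z := by
    intro z hz
    obtain ⟨D, hD, hODE⟩ := hasDerivAt_laplace_besselJ_zero hz
    have hsl := one_add_sq_mem_slitPlane hz
    have hne : 1 + z ^ 2 ≠ 0 := Complex.slitPlane_ne_zero hsl
    have hp := (((hasDerivAt_id z).pow 2).const_add 1).cpow_const (c := 1 / 2) hsl
    refine (hD.mul hp).congr_deriv ?_
    simp only [id, Pi.pow_apply, Complex.cpow_sub _ _ hne, Complex.cpow_one]
    field_simp
    push_cast
    linear_combination (2 * (1 + z ^ 2) ^ (1 / 2 : ℂ)) * hODE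
  have hconst : ∀ x : ℝ, 0 < x → G x = G s := fun x hx =>
    (isOpen_lt continuous_const Complex.continuous_re).is_const_of_deriv_eq_zero
      (convex_halfSpace_re_gt 0).isPreconnected
      (fun z hz => (hG z hz).differentiableAt.differentiableWithinAt)
      (fun z hz => (hG z hz).deriv) (by simpa using hx) hs
  -- the constant value of `G` is read off at `+∞` on the real axis, where `s L(s) = 1 + O(1/s)`
  have hL1 : Tendsto (fun x : ℝ => laplace (besselJ 1) x) atTop (𝓝 0) := by
    refine squeeze_zero_norm' ?_ (tendsto_inv_atTop_zero (𝕜 := ℝ))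
    filter_upwards [eventually_gt_atTop 0] with x hx
    simpa using norm_laplace_le (fun t => abs_besselJ_one_le) (s := (x : ℂ)) (by simpa using hx)
  have hsq : Tendsto (fun x : ℝ => ((Real.sqrt (1 + (x⁻¹) ^ 2) : ℝ) : ℂ)) atTop (𝓝 1) := by
    have h1 : Tendsto (fun x : ℝ => Real.sqrt (1 + (x⁻¹) ^ 2)) atTop
        (𝓝 (Real.sqrt (1 + 0 ^ 2))) :=
      ((tendsto_inv_atTop_zero.pow 2).const_add 1).sqrt
    simpa [Function.comp_def] using (Complex.continuous_ofReal.tendsto _).comp h1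
  have hlim : Tendsto (fun x : ℝ => G x) atTop (𝓝 1) := by
    have h := (hL1.const_sub 1).mul hsq
    rw [sub_zero, mul_one] at h
    refine h.congr' ?_
    filter_upwards [eventually_gt_atTop 0] with x hx
    have hx0 : (x : ℂ) ≠ 0 := by exact_mod_cast hx.ne'
    have h1 : ((1 : ℂ) + (x : ℂ) ^ 2) ^ (1 / 2 : ℂ) =
        (x : ℂ) * ((Real.sqrt (1 + (x⁻¹) ^ 2) : ℝ) : ℂ) := by
      have h2 : (x : ℝ) * Real.sqrt (1 + (x⁻¹) ^ 2) = (1 + x ^ 2) ^ (1 / 2 : ℝ) := by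
        rw [← Real.sqrt_eq_rpow, eq_comm, Real.sqrt_eq_iff_mul_self_eq_of_pos (by positivity)]
        have := Real.mul_self_sqrt (show 0 ≤ 1 + (x⁻¹) ^ 2 by positivity)
        rw [mul_mul_mul_comm, this]
        field_simp
        ring
      rw [← Complex.ofReal_mul, h2, Complex.ofReal_cpow (by positivity)]
      push_cast
      rfl
    simp only [G]
    rw [h1, laplace_besselJ_one (by simpa using hx)]
    ring
  have hone : G s = 1 := by
    refine tendsto_nhds_unique (tendsto_const_nhds.congr' ?_) hlim
    filter_upwards [eventually_gt_atTop 0] with x hx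
    exact (hconst x hx).symm
  rw [eq_comm, show (((-1 / 2 : ℝ)) : ℂ) = -(1 / 2 : ℂ) by push_cast; ring, Complex.cpow_neg]
  exact (eq_inv_of_mul_eq_one_left hone).symm

theorem one_add_sq_re_im (ε x : ℝ) : (1 : ℂ) + ((ε : ℂ) + Complex.I * x) ^ 2 =
    ((1 - x ^ 2 + ε ^ 2 : ℝ) : ℂ) + ((2 * ε * x : ℝ) : ℂ) * Complex.I := by
  push_cast
  linear_combination (x : ℂ) ^ 2 * Complex.I_sq

theorem norm_laplace_besselJ_zero_le {ε x : ℝ} (hε : 0 < ε) (hx : x ^ 2 - 1 ≠ 0) :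
    ‖laplace (besselJ 0) ((ε : ℂ) + Complex.I * x)‖ ≤ |x ^ 2 - 1| ^ (-1 / 2 : ℝ) := by
  rw [laplace_besselJ_zero (by simpa using hε), Complex.norm_cpow_real]
  refine Real.rpow_le_rpow_of_nonpos (abs_pos.mpr hx) ?_ (by norm_num)
  rw [one_add_sq_re_im, Complex.norm_add_mul_I]
  refine Real.abs_le_sqrt ?_
  nlinarith [sq_nonneg (ε * x), sq_nonneg ε, sq_nonneg (ε ^ 2)]

theorem ofReal_cpow_neg_half {r : ℝ} (hr : 0 ≤ r) :
    (r : ℂ) ^ ((-1 / 2 : ℝ) : ℂ) = ((1 / Real.sqrt r : ℝ) : ℂ) := by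
  rw [← Complex.ofReal_cpow hr, show (-1 / 2 : ℝ) = -(1 / 2) by norm_num, Real.rpow_neg hr,
    Real.sqrt_eq_rpow, one_div (r ^ _)]

theorem tendsto_one_add_sq (x : ℝ) :
    Tendsto (fun ε : ℝ => (1 : ℂ) + ((ε : ℂ) + Complex.I * x) ^ 2) (𝓝[>] 0)
      (𝓝 ((1 - x ^ 2 : ℝ) : ℂ)) := by
  have h : Continuous fun ε : ℝ => (1 : ℂ) + ((ε : ℂ) + Complex.I * x) ^ 2 := by fun_prop
  have h0 := (h.tendsto 0).mono_left (nhdsWithin_le_nhds (s := Set.Ioi 0))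
  rwa [one_add_sq_re_im, show ((1 - x ^ 2 + 0 ^ 2 : ℝ) : ℂ) + ((2 * 0 * x : ℝ) : ℂ) * Complex.I =
    ((1 - x ^ 2 : ℝ) : ℂ) by simp] at h0

theorem tendsto_laplace_besselJ_zero_of_abs_lt {x : ℝ} (hx : |x| < 1) :
    Tendsto (fun ε : ℝ => laplace (besselJ 0) ((ε : ℂ) + Complex.I * x)) (𝓝[>] 0)
      (𝓝 ((1 / Real.sqrt (1 - x ^ 2) : ℝ) : ℂ)) := by
  have hx' : 0 < 1 - x ^ 2 := by
    have := (sq_lt_one_iff_abs_lt_one x).mpr hx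
    linarith
  have h := (continuousAt_cpow_const (b := ((-1 / 2 : ℝ) : ℂ))
    (Complex.ofReal_mem_slitPlane.mpr hx')).tendsto.comp (tendsto_one_add_sq x)
  rw [ofReal_cpow_neg_half hx'.le] at h
  refine h.congr' ?_
  filter_upwards [self_mem_nhdsWithin] with ε hε
  exact (laplace_besselJ_zero (by simpa using hε)).symm

/-- For `x > 1` the point `1 + (ε + ix)²` approaches the negative number `1 - x²` from above, the
side from which the principal branch is continuous. -/
theorem tendsto_laplace_besselJ_zero_of_one_lt {x : ℝ} (hx : 1 < x) :
    Tendsto (fun ε : ℝ => laplace (besselJ 0) ((ε : ℂ) + Complex.I * x)) (𝓝[>] 0)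
      (𝓝 (-(Complex.I * ((1 / Real.sqrt (x ^ 2 - 1) : ℝ) : ℂ)))) := by
  have hx' : 1 - x ^ 2 < 0 := by nlinarith
  have hne : ((1 - x ^ 2 : ℝ) : ℂ) ≠ 0 := by exact_mod_cast hx'.ne
  have hlog := Complex.continuousWithinAt_log_of_re_neg_of_im_zero
    (z := ((1 - x ^ 2 : ℝ) : ℂ)) (by rwa [Complex.ofReal_re]) (Complex.ofReal_im _)
  have harg : Tendsto (fun ε : ℝ => (1 : ℂ) + ((ε : ℂ) + Complex.I * x) ^ 2) (𝓝[>] 0)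
      (𝓝[{z : ℂ | 0 ≤ z.im}] ((1 - x ^ 2 : ℝ) : ℂ)) := by
    refine tendsto_nhdsWithin_iff.mpr ⟨tendsto_one_add_sq x, ?_⟩
    filter_upwards [self_mem_nhdsWithin] with ε hε
    have hε' : 0 < ε := hε
    rw [one_add_sq_re_im]
    simp only [Complex.add_im, Complex.ofReal_im, Complex.im_ofReal_mul, Complex.I_im]
    positivity
  have h := (((hlog.tendsto.comp harg).mul_const ((-1 / 2 : ℝ) : ℂ))).cexp
  rw [← Complex.cpow_def_of_ne_zero hne, Complex.ofReal_cpow_of_nonpos hx'.le] at h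
  have he : Complex.exp (Real.pi * Complex.I * ((-1 / 2 : ℝ) : ℂ)) = -Complex.I := by
    rw [show (Real.pi : ℂ) * Complex.I * ((-1 / 2 : ℝ) : ℂ) = -(Real.pi / 2 * Complex.I) by
      push_cast; ring, Complex.exp_neg, Complex.exp_pi_div_two_mul_I, Complex.inv_I]
  rw [he, ← Complex.ofReal_neg, ofReal_cpow_neg_half (by linarith), neg_sub, mul_neg,
    mul_comm _ Complex.I] at h
  refine h.congr' ?_
  filter_upwards [self_mem_nhdsWithin] with ε hε
  have hre : 0 < ((ε : ℂ) + Complex.I * x).re := by simpa using hε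
  rw [laplace_besselJ_zero hre, Complex.cpow_def_of_ne_zero
    (Complex.slitPlane_ne_zero (one_add_sq_mem_slitPlane hre))]
  rfl

/-- The mirror case, by complex conjugation. -/
theorem tendsto_laplace_besselJ_zero_of_lt_neg_one {x : ℝ} (hx : x < -1) :
    Tendsto (fun ε : ℝ => laplace (besselJ 0) ((ε : ℂ) + Complex.I * x)) (𝓝[>] 0)
      (𝓝 (Complex.I * ((1 / Real.sqrt (x ^ 2 - 1) : ℝ) : ℂ))) := by
  have h := (Complex.continuous_conj.tendsto _).comp
    (tendsto_laplace_besselJ_zero_of_one_lt (x := -x) (by linarith))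
  simp only [Function.comp_def, conj_laplace] at h
  simpa using h

/-! ### Abel summation of Fourier transforms against Schwartz functions -/

theorem fourierInt_eq_vectorFourier (f : ℝ → ℂ) :
    fourierInt f = VectorFourier.fourierIntegral Real.probChar volume (LinearMap.mul ℝ ℝ) f := by
  ext ω
  simp only [fourierInt, VectorFourier.fourierIntegral, Circle.smul_def, Real.probChar_apply,
    LinearMap.mul_apply', smul_eq_mul]
  congr 1
  ext x
  rw [mul_comm]
  congr 2
  push_cast
  ring

theorem continuous_fourierInt {f : ℝ → ℂ} (hf : Integrable f) : Continuous (fourierInt f) := by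
  rw [fourierInt_eq_vectorFourier]
  exact VectorFourier.fourierIntegral_continuous Real.continuous_probChar
    (by simp only [LinearMap.mul_apply']; fun_prop) hf

/-- The multiplication formula, an instance of Fubini's theorem. -/
theorem integral_fourierInt_mul {f g : ℝ → ℂ} (hf : Integrable f) (hg : Integrable g) :
    ∫ ξ, fourierInt f ξ * g ξ = ∫ x, f x * fourierInt g x := by
  have hflip : (LinearMap.mul ℝ ℝ).flip = LinearMap.mul ℝ ℝ := by
    ext
    simp
  have h := VectorFourier.integral_fourierIntegral_smul_eq_flip (μ := volume) (ν := volume)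
    (L := LinearMap.mul ℝ ℝ) Real.continuous_probChar
    (by simp only [LinearMap.mul_apply']; fun_prop) hf hg
  simpa only [hflip, ← fourierInt_eq_vectorFourier, smul_eq_mul] using h

/-- Fourier inversion in the normalization without `2π` in the exponent. -/
theorem fourierInt_schwartzFourier_neg (φ : 𝓢(ℝ, ℂ)) (ω : ℝ) :
    fourierInt (fun x => schwartzFourier φ (-x)) ω = 2 * Real.pi * φ ω := by
  have hpi : (Real.pi : ℂ) ≠ 0 := by exact_mod_cast Real.pi_ne_zero
  have hinv : ∫ v : ℝ, 𝓕 φ v * Complex.exp (2 * Real.pi * Complex.I * ω * v) = φ ω := by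
    have h : 𝓕⁻ (𝓕 φ) ω = φ ω := by rw [FourierTransform.fourierInv_fourier_eq]
    rw [← h, SchwartzMap.fourierInv_coe, Real.fourierInv_eq']
    congr 1
    ext v
    rw [smul_eq_mul, mul_comm]
    congr 2
    simp only [RCLike.inner_apply, conj_trivial]
    push_cast
    ring
  have hs := Measure.integral_comp_mul_right
    (fun v : ℝ => 𝓕 φ v * Complex.exp (2 * Real.pi * Complex.I * ω * v)) (-(2 * Real.pi)⁻¹)
  rw [hinv] at hs
  have ha : |(-(2 * Real.pi)⁻¹)⁻¹| = 2 * Real.pi := by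
    rw [← neg_inv, inv_inv, abs_neg, abs_of_pos (by positivity)]
  rw [ha, Complex.real_smul] at hs
  push_cast at hs
  rw [← hs, fourierInt]
  congr 1
  ext x
  have h : schwartzFourier φ (-x) = 𝓕 φ (x * -(2 * Real.pi)⁻¹) := by
    rw [mul_neg, ← neg_mul]
    rfl
  rw [h]
  congr 2
  field_simp

/-- If the Fourier transforms of the damped functions `e^{-ε|ω|} k(ω)` converge to `K`, dominated
by a weight that is integrable against Schwartz functions, then `K` is the Fourier transform of the
bounded function `k` in the sense of tempered distributions. -/
theorem integral_mul_schwartzFourier_neg_of_tendsto {k K : ℝ → ℂ} {B : ℝ → ℝ} {C : ℝ}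
    (hkC : ∀ ω, ‖k ω‖ ≤ C)
    (hki : ∀ ε : ℝ, 0 < ε → Integrable fun ω : ℝ => (Real.exp (-ε * |ω|) : ℂ) * k ω)
    (hlim : ∀ᵐ x : ℝ, Tendsto (fun ε : ℝ => fourierInt (fun ω => (Real.exp (-ε * |ω|) : ℂ) * k ω) x)
      (𝓝[>] 0) (𝓝 (K x)))
    (hB : ∀ ε : ℝ, 0 < ε → ε ≤ 1 → ∀ᵐ x : ℝ,
      ‖fourierInt (fun ω => (Real.exp (-ε * |ω|) : ℂ) * k ω) x‖ ≤ B x)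
    (φ : 𝓢(ℝ, ℂ)) (hBi : Integrable fun x => B x * ‖schwartzFourier φ (-x)‖) :
    ∫ x, K x * schwartzFourier φ (-x) = 2 * Real.pi * ∫ ω, k ω * φ ω := by
  have hg : Integrable fun x => schwartzFourier φ (-x) := (schwartzFourier φ).integrable.comp_neg
  have hIoc : ∀ᶠ ε : ℝ in 𝓝[>] 0, 0 < ε ∧ ε ≤ 1 := by
    filter_upwards [Ioc_mem_nhdsGT (zero_lt_one' ℝ)] with ε hε using hε
  have hleft : Tendsto (fun ε : ℝ =>
      ∫ x, fourierInt (fun ω => (Real.exp (-ε * |ω|) : ℂ) * k ω) x * schwartzFourier φ (-x))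
      (𝓝[>] 0) (𝓝 (∫ x, K x * schwartzFourier φ (-x))) := by
    refine tendsto_integral_filter_of_dominated_convergence _ ?_ ?_ hBi ?_
    · filter_upwards [hIoc] with ε hε
      exact (continuous_fourierInt (hki ε hε.1)).aestronglyMeasurable.mul hg.aestronglyMeasurable
    · filter_upwards [hIoc] with ε hε
      filter_upwards [hB ε hε.1 hε.2] with x hx
      rw [norm_mul]
      exact mul_le_mul_of_nonneg_right hx (norm_nonneg _)
    · filter_upwards [hlim] with x hx using hx.mul_const _
  have hright : Tendsto (fun ε : ℝ => ∫ ω : ℝ, (Real.exp (-ε * |ω|) : ℂ) * k ω * (2 * Real.pi * φ ω))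
      (𝓝[>] 0) (𝓝 (∫ ω, k ω * (2 * Real.pi * φ ω))) := by
    refine tendsto_integral_filter_of_dominated_convergence
      (fun ω => C * ‖(2 * Real.pi : ℂ) * φ ω‖) ?_ ?_ ((φ.integrable.const_mul _).norm.const_mul C) ?_
    · filter_upwards [hIoc] with ε hε
      exact (hki ε hε.1).aestronglyMeasurable.mul (φ.integrable.const_mul _).aestronglyMeasurable
    · filter_upwards [hIoc] with ε hε
      refine Eventually.of_forall fun ω => ?_
      rw [norm_mul, norm_mul, Complex.norm_real, Real.norm_of_nonneg (Real.exp_pos _).le]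
      have h1 : Real.exp (-ε * |ω|) ≤ 1 :=
        Real.exp_le_one_iff.mpr (by nlinarith [abs_nonneg ω, hε.1])
      exact mul_le_mul_of_nonneg_right
        ((mul_le_of_le_one_left (norm_nonneg _) h1).trans (hkC ω)) (norm_nonneg _)
    · refine Eventually.of_forall fun ω => ?_
      have hc : Continuous fun ε : ℝ => (Real.exp (-ε * |ω|) : ℂ) * k ω * (2 * Real.pi * φ ω) := by
        fun_prop
      simpa using (hc.tendsto 0).mono_left (nhdsWithin_le_nhds (s := Set.Ioi 0))
  have heq := tendsto_nhds_unique (hleft.congr' (by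
    filter_upwards [hIoc] with ε hε
    rw [integral_fourierInt_mul (hki ε hε.1) hg]
    simp only [fourierInt_schwartzFourier_neg])) hright
  rw [heq, ← integral_const_mul]
  congr 1
  ext ω
  ring

/-- The damped Fourier transform of an even (`σ = 1`) or odd (`σ = -1`) function, in terms of the
Laplace transform of its restriction to the half-line. -/
theorem fourierInt_exp_neg_abs_mul {f : ℝ → ℝ} (hf : Continuous f)
    (hb : ∀ t, 0 ≤ t → |f t| ≤ 1) {k : ℝ → ℂ} {σ : ℂ} (hpos : ∀ t, 0 < t → k t = f t)
    (hneg : ∀ t, 0 < t → k (-t) = σ * f t) {ε : ℝ} (hε : 0 < ε) (x : ℝ) :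
    Integrable (fun ω : ℝ => (Real.exp (-ε * |ω|) : ℂ) * k ω) ∧
    fourierInt (fun ω => (Real.exp (-ε * |ω|) : ℂ) * k ω) x =
      laplace f ((ε : ℂ) + Complex.I * x) +
        σ * laplace f ((ε : ℂ) + Complex.I * ((-x : ℝ) : ℂ)) := by
  have hs : ∀ y : ℝ, 0 < ((ε : ℂ) + Complex.I * y).re := fun y => by simpa using hε
  let G : ℝ → ℝ → ℂ := fun y ω =>
    (Real.exp (-ε * |ω|) : ℂ) * k ω * Complex.exp (-(Complex.I * y * ω))
  have hGpos : ∀ y, Set.EqOn (G y)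
      (fun t : ℝ => (f t : ℂ) * Complex.exp (-(((ε : ℂ) + Complex.I * y) * t))) (Set.Ioi 0) := by
    intro y t ht
    simp only [G]
    rw [hpos t ht, abs_of_pos ht, show -(((ε : ℂ) + Complex.I * y) * t) =
      ((-ε * t : ℝ) : ℂ) + -(Complex.I * y * t) by push_cast; ring, Complex.exp_add,
      Complex.ofReal_exp]
    ring
  have hGneg : ∀ y, Set.EqOn (fun t => G y (-t))
      (fun t : ℝ => σ * ((f t : ℂ) *
        Complex.exp (-(((ε : ℂ) + Complex.I * ((-y : ℝ) : ℂ)) * t)))) (Set.Ioi 0) := by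
    intro y t ht
    simp only [G]
    rw [hneg t ht, abs_neg, abs_of_pos ht, show -(((ε : ℂ) + Complex.I * ((-y : ℝ) : ℂ)) * t) =
      ((-ε * t : ℝ) : ℂ) + -(Complex.I * y * ((-t : ℝ) : ℂ)) by push_cast; ring, Complex.exp_add,
      Complex.ofReal_exp]
    ring
  have hi1 : ∀ y, IntegrableOn (G y) (Set.Ioi 0) := fun y =>
    (integrableOn_congr_fun (hGpos y) measurableSet_Ioi).mpr (integrableOn_mul_exp hf hb (hs y))
  have hi2 : ∀ y, IntegrableOn (G y) (Set.Iic 0) := by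
    intro y
    have h : IntegrableOn (fun t => G y (-t)) (Set.Ioi 0) :=
      (integrableOn_congr_fun (hGneg y) measurableSet_Ioi).mpr
        ((integrableOn_mul_exp hf hb (hs (-y))).const_mul σ)
    have h' := h.comp_neg
    rw [integrableOn_Iic_iff_integrableOn_Iio]
    simpa using h'
  constructor
  · have h : Integrable (G 0) := by
      rw [← integrableOn_univ, ← Set.Iic_union_Ioi (a := (0 : ℝ))]
      exact (hi2 0).union (hi1 0)
    simpa [G] using h
  · change ∫ ω, G x ω = _
    rw [← intervalIntegral.integral_Iic_add_Ioi (hi2 x) (hi1 x),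
      setIntegral_congr_fun measurableSet_Ioi (hGpos x)]
    have h := integral_comp_neg_Ioi (0 : ℝ) (G x)
    rw [neg_zero] at h
    rw [← h, setIntegral_congr_fun measurableSet_Ioi (hGneg x), integral_const_mul, add_comm]
    rfl

/-! ### The inverse square root singularity -/

/-- The function `|y|^{-1/2}` cut off to the interval `(-1, 1)`; its value at `0` is `0`. -/
noncomputable def invSqrtSing : ℝ → ℝ :=
  (Set.Ioo (-1) 1).indicator fun y => |y| ^ (-1 / 2 : ℝ)

theorem invSqrtSing_nonneg (y : ℝ) : 0 ≤ invSqrtSing y :=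
  Set.indicator_nonneg (fun _ _ => by positivity) y

theorem invSqrtSing_of_abs_lt {y : ℝ} (hy : |y| < 1) : invSqrtSing y = |y| ^ (-1 / 2 : ℝ) :=
  Set.indicator_of_mem (show y ∈ Set.Ioo (-1 : ℝ) 1 from abs_lt.mp hy) _

theorem measurable_invSqrtSing : Measurable invSqrtSing :=
  (measurable_norm.pow_const _).indicator measurableSet_Ioo

theorem abs_rpow_neg_half_le (y : ℝ) : |y| ^ (-1 / 2 : ℝ) ≤ 1 + invSqrtSing y := by
  rcases lt_or_ge |y| 1 with h | h
  · rw [invSqrtSing_of_abs_lt h]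
    linarith
  · linarith [Real.rpow_le_one_of_one_le_of_nonpos h (by norm_num : (-1 / 2 : ℝ) ≤ 0),
      invSqrtSing_nonneg y]

theorem integrable_invSqrtSing_rpow {r : ℝ} (hr0 : 0 < r) (hr : r < 2) :
    Integrable fun y => invSqrtSing y ^ r := by
  have h : (fun y => invSqrtSing y ^ r) =
      (Set.Ioo (-1) 1).indicator fun y => |y| ^ (-(r / 2)) := by
    ext y
    by_cases hy : y ∈ Set.Ioo (-1 : ℝ) 1
    · rw [invSqrtSing_of_abs_lt (abs_lt.mpr hy), Set.indicator_of_mem hy,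
        ← Real.rpow_mul (abs_nonneg y)]
      congr 1
      ring
    · rw [invSqrtSing, Set.indicator_of_notMem hy, Set.indicator_of_notMem hy,
        Real.zero_rpow hr0.ne']
  rw [h, integrable_indicator_iff measurableSet_Ioo]
  have h1 : IntegrableOn (fun y : ℝ => |y| ^ (-(r / 2))) (Set.Ioo 0 1) :=
    (integrableOn_congr_fun (g := fun y : ℝ => y ^ (-(r / 2)))
      (fun y hy => by simp only [abs_of_pos hy.1]) measurableSet_Ioo).mpr
      ((intervalIntegral.integrableOn_Ioo_rpow_iff one_pos).mpr (by linarith))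
  have h2 := h1.comp_neg
  simp only [abs_neg, Set.neg_Ioo, neg_zero] at h2
  refine ((h2.union (integrableOn_singleton (x := (0 : ℝ)) (by simp) (by simp))).union h1).mono_set ?_
  intro y hy
  rcases lt_trichotomy y 0 with h0 | h0 | h0
  · exact Or.inl (Or.inl ⟨hy.1, h0⟩)
  · exact Or.inl (Or.inr h0)
  · exact Or.inr ⟨h0, hy.2⟩

theorem memLp_invSqrtSing {p : ℝ≥0∞} (hp0 : p ≠ 0) (hp : p < 2) : MemLp invSqrtSing p := by
  have hpt : p ≠ ∞ := (hp.trans ENNReal.ofNat_lt_top).ne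
  refine (integrable_norm_rpow_iff measurable_invSqrtSing.aestronglyMeasurable hp0 hpt).mp ?_
  simp only [Real.norm_of_nonneg (invSqrtSing_nonneg _)]
  refine integrable_invSqrtSing_rpow (ENNReal.toReal_pos hp0 hpt) ?_
  simpa using (ENNReal.toReal_lt_toReal hpt (by simp)).mpr hp

theorem integrable_invSqrtSing : Integrable invSqrtSing :=
  memLp_one_iff_integrable.mp (memLp_invSqrtSing one_ne_zero ENNReal.one_lt_two)

theorem memLp_one_add_abs_rpow {p : ℝ≥0∞} (hp0 : p ≠ 0) (hpt : p ≠ ∞) {r : ℝ}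
    (hr : 1 < r * p.toReal) : MemLp (fun x : ℝ => (1 + |x|) ^ (-r)) p := by
  have hc : Continuous fun x : ℝ => (1 + |x|) ^ (-r) :=
    (continuous_const.add continuous_abs).rpow_const fun x =>
      Or.inl (by positivity : (0 : ℝ) < 1 + |x|).ne'
  refine (integrable_norm_rpow_iff hc.aestronglyMeasurable hp0 hpt).mp ?_
  have h := integrable_one_add_norm (E := ℝ) (μ := volume) (r := r * p.toReal) (by simpa using hr)
  refine h.congr (Eventually.of_forall fun x => ?_)
  have h0 : 0 ≤ 1 + |x| := by positivity
  simp only [Real.norm_of_nonneg (Real.rpow_nonneg h0 _), Real.norm_eq_abs]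
  rw [← Real.rpow_mul h0, neg_mul]

/-- The singularities of `|x² - 1|^{-1/2}` at `±1` are separated: one of the factors `|x ∓ 1|` is at
least one. -/
theorem abs_sq_sub_one_rpow_le (x : ℝ) :
    |x ^ 2 - 1| ^ (-1 / 2 : ℝ) ≤ 1 + invSqrtSing (x - 1) + invSqrtSing (x + 1) := by
  have hm : |x ^ 2 - 1| ^ (-1 / 2 : ℝ) = |x - 1| ^ (-1 / 2 : ℝ) * |x + 1| ^ (-1 / 2 : ℝ) := by
    rw [← Real.mul_rpow (abs_nonneg _) (abs_nonneg _), ← abs_mul]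
    congr 2
    ring
  rw [hm]
  have hn : (-1 / 2 : ℝ) ≤ 0 := by norm_num
  have h1 := abs_rpow_neg_half_le (x - 1)
  have h2 := abs_rpow_neg_half_le (x + 1)
  have p1 : 0 ≤ |x - 1| ^ (-1 / 2 : ℝ) := by positivity
  have p2 : 0 ≤ |x + 1| ^ (-1 / 2 : ℝ) := by positivity
  have n1 := invSqrtSing_nonneg (x - 1)
  have n2 := invSqrtSing_nonneg (x + 1)
  rcases le_total 0 x with h | h
  · have h3 : |x + 1| ^ (-1 / 2 : ℝ) ≤ 1 :=
      Real.rpow_le_one_of_one_le_of_nonpos ((by linarith : 1 ≤ x + 1).trans (le_abs_self _)) hn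
    nlinarith
  · have h3 : |x - 1| ^ (-1 / 2 : ℝ) ≤ 1 :=
      Real.rpow_le_one_of_one_le_of_nonpos ((by linarith : 1 ≤ -(x - 1)).trans (neg_le_abs _)) hn
    nlinarith

theorem inv_sqrt_sq_sub_one_le_of_lt_two {x : ℝ} (h1 : 1 < |x|) (h2 : |x| < 2) :
    1 / Real.sqrt (x ^ 2 - 1) ≤ invSqrtSing (x - 1) + invSqrtSing (x + 1) := by
  have key : 1 / Real.sqrt (x ^ 2 - 1) ≤ invSqrtSing (|x| - 1) := by
    have h0 : 0 < |x| - 1 := by linarith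
    have habs : |(|x| - 1)| = |x| - 1 := abs_of_pos h0
    rw [invSqrtSing_of_abs_lt (by rw [habs]; linarith), habs,
      show (-1 / 2 : ℝ) = -(1 / 2) by norm_num, Real.rpow_neg h0.le, ← Real.sqrt_eq_rpow, one_div]
    refine inv_anti₀ (Real.sqrt_pos.mpr h0) (Real.sqrt_le_sqrt ?_)
    rw [← sq_abs]
    nlinarith
  refine key.trans ?_
  rcases abs_choice x with h | h
  · rw [h]
    linarith [invSqrtSing_nonneg (x + 1)]
  · have he : invSqrtSing (|x| - 1) = invSqrtSing (x + 1) := by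
      have h3 : |(|x| - 1)| = |x + 1| := by
        rw [h, ← abs_neg]
        congr 1
        ring
      have h4 : |(|x| - 1)| < 1 := by
        rw [abs_lt]
        constructor <;> linarith
      rw [invSqrtSing_of_abs_lt h4, invSqrtSing_of_abs_lt (h3 ▸ h4), h3]
    rw [he]
    linarith [invSqrtSing_nonneg (x - 1)]

/-! ### Size of the extended Chebyshev functions -/

theorem abs_extendedUNegOne_le (x : ℝ) :
    |extendedUNegOne x| ≤ 2 * (1 + |x|) ^ (-1 : ℝ) + (invSqrtSing (x - 1) + invSqrtSing (x + 1)) := by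
  have hw : 0 ≤ 2 * (1 + |x|) ^ (-1 : ℝ) := by positivity
  have hs := add_nonneg (invSqrtSing_nonneg (x - 1)) (invSqrtSing_nonneg (x + 1))
  unfold extendedUNegOne
  split_ifs with h
  · rw [abs_zero]
    positivity
  · rw [not_le] at h
    have hsign : |Real.sign x| = 1 := by
      rcases Real.sign_apply_eq_of_ne_zero x (by rintro rfl; norm_num at h) with h' | h' <;>
        simp [h']
    rw [abs_neg, abs_div, hsign, abs_of_nonneg (Real.sqrt_nonneg _)]
    rcases lt_or_ge |x| 2 with h2 | h2
    · linarith [inv_sqrt_sq_sub_one_le_of_lt_two h h2]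
    · have h3 : (1 + |x|) / 2 ≤ Real.sqrt (x ^ 2 - 1) := by
        refine Real.le_sqrt_of_sq_le ?_
        rw [← sq_abs x]
        nlinarith
      have h4 := one_div_le_one_div_of_le (by positivity) h3
      have h5 : 1 / ((1 + |x|) / 2) = 2 * (1 + |x|) ^ (-1 : ℝ) := by
        rw [Real.rpow_neg_one]
        field_simp
      linarith

theorem extendedUZero_of_abs_le {x : ℝ} (hx : |x| ≤ 1) : extendedUZero x = 1 := by
  simp [extendedUZero, extendedT, extendedUNegTwo, hx]

theorem extendedUZero_of_one_lt_abs {x : ℝ} (hx : 1 < |x|) :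
    extendedUZero x = 1 - |x| / Real.sqrt (x ^ 2 - 1) := by
  simp [extendedUZero, extendedT, extendedUNegTwo, hx.not_ge, sub_eq_add_neg]

theorem abs_extendedUZero_le (x : ℝ) :
    |extendedUZero x| ≤
      4 * (1 + |x|) ^ (-2 : ℝ) + 2 * (invSqrtSing (x - 1) + invSqrtSing (x + 1)) := by
  have hw : 4 * (1 + |x|) ^ (-2 : ℝ) = 4 / (1 + |x|) ^ 2 := by
    rw [Real.rpow_neg (by positivity), Real.rpow_two]
    rfl
  have hw0 : 0 ≤ 4 * (1 + |x|) ^ (-2 : ℝ) := by positivity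
  have hs := add_nonneg (invSqrtSing_nonneg (x - 1)) (invSqrtSing_nonneg (x + 1))
  rcases le_or_gt |x| 1 with h | h
  · rw [extendedUZero_of_abs_le h, abs_one, hw]
    have : 1 ≤ 4 / (1 + |x|) ^ 2 := by
      rw [le_div_iff₀ (by positivity)]
      nlinarith [abs_nonneg x]
    linarith
  · have hr2 : Real.sqrt (x ^ 2 - 1) ^ 2 = |x| ^ 2 - 1 := by
      rw [Real.sq_sqrt (by rw [← sq_abs]; nlinarith), sq_abs]
    have hr0 : 0 < Real.sqrt (x ^ 2 - 1) :=
      Real.sqrt_pos.mpr (by rw [← sq_abs]; nlinarith)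
    have hrx : Real.sqrt (x ^ 2 - 1) ≤ |x| := by nlinarith
    have h1 : 1 ≤ |x| / Real.sqrt (x ^ 2 - 1) := (one_le_div hr0).mpr hrx
    rw [extendedUZero_of_one_lt_abs h, abs_sub_comm, abs_of_nonneg (by linarith)]
    rcases lt_or_ge |x| 2 with h2 | h2
    · have h3 := inv_sqrt_sq_sub_one_le_of_lt_two h h2
      have h4 : |x| / Real.sqrt (x ^ 2 - 1) = |x| * (1 / Real.sqrt (x ^ 2 - 1)) := by ring
      rw [h4]
      nlinarith
    · -- with `r = √(x² - 1)`, `|x| / r - 1 = 1 / (r (|x| + r)) ≤ 1 / r²`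
      have h3 : |x| / Real.sqrt (x ^ 2 - 1) - 1 ≤ 4 / (1 + |x|) ^ 2 := by
        set r := Real.sqrt (x ^ 2 - 1)
        have h5 : |x| / r - 1 = 1 / (r * (|x| + r)) := by
          field_simp
          linarith
        have h6 : (1 + |x|) ^ 2 / 4 ≤ r * (|x| + r) := by nlinarith
        have h7 := one_div_le_one_div_of_le (by positivity) h6
        rw [h5]
        refine h7.trans_eq ?_
        field_simp
      linarith

theorem measurable_extendedUNegOne : Measurable extendedUNegOne := by
  unfold extendedUNegOne Real.sign
  refine Measurable.ite (measurableSet_le (by fun_prop) (by fun_prop)) (by fun_prop) ?_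
  refine (Measurable.div ?_ (by fun_prop)).neg
  exact Measurable.ite measurableSet_Iio (by fun_prop)
    (Measurable.ite measurableSet_Ioi (by fun_prop) (by fun_prop))

theorem measurable_extendedUZero : Measurable extendedUZero := by
  have h : extendedUZero =
      fun x => if |x| ≤ 1 then 1 else 1 - |x| / Real.sqrt (x ^ 2 - 1) := by
    ext x
    split_ifs with hx
    · exact extendedUZero_of_abs_le hx
    · exact extendedUZero_of_one_lt_abs (not_le.mp hx)
  rw [h]
  exact Measurable.ite (measurableSet_le (by fun_prop) (by fun_prop)) (by fun_prop) (by fun_prop)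

theorem memLp_comp_add_right_real {f : ℝ → ℝ} {p : ℝ≥0∞} (hf : MemLp f p) (a : ℝ) :
    MemLp (fun x => f (x + a)) p :=
  hf.comp_measurePreserving (measurePreserving_add_right volume a)

theorem memLp_extendedUNegOne {p : ℝ≥0∞} (hp1 : 1 < p) (hp2 : p < 2) :
    MemLp (fun x : ℝ => (extendedUNegOne x : ℂ)) p := by
  have hp0 : p ≠ 0 := (zero_lt_one.trans hp1).ne'
  have hpt : p ≠ ∞ := (hp2.trans ENNReal.ofNat_lt_top).ne
  have hr : 1 < p.toReal := by
    simpa using (ENNReal.toReal_lt_toReal (by simp) hpt).mpr hp1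
  have hg := memLp_invSqrtSing hp0 hp2
  refine (((memLp_one_add_abs_rpow hp0 hpt (r := 1) (by simpa using hr)).const_mul 2).add
    ((memLp_comp_add_right_real hg (-1)).add (memLp_comp_add_right_real hg 1))).mono'
    (Complex.measurable_ofReal.comp measurable_extendedUNegOne).aestronglyMeasurable
    (Eventually.of_forall fun x => ?_)
  rw [Complex.norm_real]
  exact abs_extendedUNegOne_le x

theorem integrable_extendedUZero : Integrable fun x : ℝ => (extendedUZero x : ℂ) := by
  have hg := integrable_invSqrtSing
  have hw : Integrable fun x : ℝ => (1 + |x|) ^ (-2 : ℝ) :=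
    integrable_one_add_norm (E := ℝ) (r := 2) (by norm_num)
  refine ((hw.const_mul 4).add (((hg.comp_sub_right 1).add (hg.comp_add_right 1)).const_mul 2)).mono'
    (Complex.measurable_ofReal.comp measurable_extendedUZero).aestronglyMeasurable
    (Eventually.of_forall fun x => ?_)
  rw [Complex.norm_real]
  exact abs_extendedUZero_le x

theorem memLp_mul_besselJ_zero_div_abs {q : ℝ≥0∞} (hq : 2 < q) (hqt : q ≠ ∞) :
    MemLp (fun ω : ℝ =>
      Complex.I * (ω : ℂ) * (Real.pi : ℂ) * (besselJ 0 ω : ℂ) / ((|ω| : ℝ) : ℂ)) q := by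
  obtain ⟨C, hC⟩ := exists_one_add_abs_mul_besselJ_zero_sq_le
  have hr : 2 < q.toReal := by
    simpa using (ENNReal.toReal_lt_toReal (by simp) hqt).mpr hq
  have hJ := (continuous_besselJ 0).measurable
  refine ((memLp_one_add_abs_rpow (r := 1 / 2) (pos_of_gt hq).ne' hqt (by linarith)).const_mul
    (Real.pi * Real.sqrt C)).mono' (Measurable.aestronglyMeasurable (by fun_prop))
    (Eventually.of_forall fun ω => ?_)
  have h1 : |besselJ 0 ω| ≤ Real.sqrt C * (1 + |ω|) ^ (-(1 / 2) : ℝ) := by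
    have h0 : 0 < 1 + |ω| := by positivity
    rw [Real.rpow_neg h0.le, ← Real.sqrt_eq_rpow, ← div_eq_mul_inv, ← Real.sqrt_div' _ h0.le]
    refine Real.abs_le_sqrt ?_
    rw [le_div_iff₀ h0, mul_comm]
    exact hC ω
  simp only [norm_div, norm_mul, Complex.norm_I, one_mul, Complex.norm_real, Real.norm_eq_abs,
    abs_abs, abs_of_pos Real.pi_pos]
  calc |ω| * Real.pi * |besselJ 0 ω| / |ω| = (|ω| / |ω|) * (Real.pi * |besselJ 0 ω|) := by ring
    _ ≤ 1 * (Real.pi * |besselJ 0 ω|) :=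
      mul_le_mul_of_nonneg_right (div_self_le_one _) (by positivity)
    _ ≤ _ := by
      rw [one_mul, mul_assoc]
      exact mul_le_mul_of_nonneg_left h1 Real.pi_pos.le

/-! ### The two Fourier transforms in the sense of tempered distributions -/

/-- The weight that dominates both families of damped Fourier transforms. -/
theorem integrable_weight_mul_schwartz (ψ : 𝓢(ℝ, ℂ)) :
    Integrable fun x : ℝ => 2 * (1 + (1 + |x|) * (1 + invSqrtSing (x - 1) + invSqrtSing (x + 1))) *
      ‖ψ (-x)‖ := by
  have hi0 : Integrable fun x => ‖ψ (-x)‖ := ψ.integrable.comp_neg.norm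
  have hi1 : Integrable fun x => |x| * ‖ψ (-x)‖ := by
    simpa using (ψ.integrable_pow_mul volume 1).comp_neg
  have hw : Integrable fun x => (1 + |x|) * ‖ψ (-x)‖ :=
    (hi0.add hi1).congr (Eventually.of_forall fun x => by simp; ring)
  have hcont : Continuous fun x => (1 + |x|) * ‖ψ (-x)‖ := by
    have := ψ.continuous
    fun_prop
  obtain ⟨C, hC⟩ : ∃ C : ℝ, ∀ x, ‖(1 + |x|) * ‖ψ (-x)‖‖ ≤ C := by
    refine ⟨SchwartzMap.seminorm ℝ 0 0 ψ + SchwartzMap.seminorm ℝ 1 0 ψ, fun x => ?_⟩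
    have h0 := SchwartzMap.norm_pow_mul_le_seminorm ℝ ψ 0 (-x)
    have h1 := SchwartzMap.norm_pow_mul_le_seminorm ℝ ψ 1 (-x)
    rw [Real.norm_of_nonneg (by positivity)]
    simp only [pow_zero, one_mul, pow_one, norm_neg, Real.norm_eq_abs] at h0 h1
    linarith
  have hg : ∀ a : ℝ, Integrable fun x => invSqrtSing (x + a) * ((1 + |x|) * ‖ψ (-x)‖) := fun a =>
    (integrable_invSqrtSing.comp_add_right a).mul_bdd hcont.aestronglyMeasurable
      (Eventually.of_forall hC)
  refine (((hi0.add hw).add ((hg (-1)).add (hg 1))).const_mul 2).congr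
    (Eventually.of_forall fun x => ?_)
  simp only [Pi.add_apply, sub_eq_add_neg]
  ring

theorem ae_abs_ne_one : ∀ᵐ x : ℝ, |x| ≠ 1 := by
  have h : ({1, -1} : Set ℝ).Countable := Set.to_countable _
  filter_upwards [h.ae_notMem volume] with x hx h1
  rcases (abs_eq zero_le_one).mp h1 with rfl | rfl <;> simp at hx

theorem sq_sub_one_ne_zero_of_abs_ne_one {x : ℝ} (hx : |x| ≠ 1) : x ^ 2 - 1 ≠ 0 := fun h =>
  hx ((pow_eq_one_iff_of_nonneg (abs_nonneg x) two_ne_zero).mp (by rw [sq_abs]; linarith))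

theorem norm_laplace_besselJ_zero_le_sing {ε x : ℝ} (hε : 0 < ε) (hx : |x| ≠ 1) :
    ‖laplace (besselJ 0) ((ε : ℂ) + Complex.I * x)‖ ≤
      1 + invSqrtSing (x - 1) + invSqrtSing (x + 1) :=
  (norm_laplace_besselJ_zero_le hε (sq_sub_one_ne_zero_of_abs_ne_one hx)).trans
    (abs_sq_sub_one_rpow_le x)

theorem invSqrtSing_neg (y : ℝ) : invSqrtSing (-y) = invSqrtSing y := by
  by_cases h : |y| < 1
  · rw [invSqrtSing_of_abs_lt h, invSqrtSing_of_abs_lt (by rwa [abs_neg]), abs_neg]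
  · have h1 : y ∉ Set.Ioo (-1 : ℝ) 1 := fun h' => h (abs_lt.mpr h')
    have h2 : -y ∉ Set.Ioo (-1 : ℝ) 1 := fun h' => h (abs_neg y ▸ abs_lt.mpr h')
    rw [invSqrtSing, Set.indicator_of_notMem h1, Set.indicator_of_notMem h2]

theorem norm_laplace_besselJ_zero_neg_le_sing {ε x : ℝ} (hε : 0 < ε) (hx : |x| ≠ 1) :
    ‖laplace (besselJ 0) ((ε : ℂ) + Complex.I * ((-x : ℝ) : ℂ))‖ ≤
      1 + invSqrtSing (x - 1) + invSqrtSing (x + 1) := by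
  have h := norm_laplace_besselJ_zero_le_sing (x := -x) hε (by rwa [abs_neg])
  rw [show -x - 1 = -(x + 1) by ring, show -x + 1 = -(x - 1) by ring, invSqrtSing_neg,
    invSqrtSing_neg] at h
  linarith

theorem norm_laplace_besselJ_one_le_of {ε x S : ℝ} (hε : 0 < ε) (hε1 : ε ≤ 1)
    (hS : ‖laplace (besselJ 0) ((ε : ℂ) + Complex.I * x)‖ ≤ S) :
    ‖laplace (besselJ 1) ((ε : ℂ) + Complex.I * x)‖ ≤ 1 + (1 + |x|) * S := by
  rw [laplace_besselJ_one (by simpa using hε)]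
  refine (norm_sub_le _ _).trans ?_
  rw [norm_one, norm_mul]
  have h1 : ‖(ε : ℂ) + Complex.I * x‖ ≤ 1 + |x| := by
    refine (norm_add_le _ _).trans ?_
    rw [norm_mul, Complex.norm_I, one_mul, Complex.norm_real, Complex.norm_real,
      Real.norm_of_nonneg hε.le, Real.norm_eq_abs]
    linarith
  gcongr

theorem extendedUNegOne_neg (x : ℝ) : extendedUNegOne (-x) = -extendedUNegOne x := by
  simp only [extendedUNegOne, abs_neg, even_two.neg_pow, Real.sign_neg]
  split_ifs <;> ring

theorem extendedUZero_neg (x : ℝ) : extendedUZero (-x) = extendedUZero x := by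
  rcases le_or_gt |x| 1 with h | h
  · rw [extendedUZero_of_abs_le h, extendedUZero_of_abs_le (by rwa [abs_neg])]
  · rw [extendedUZero_of_one_lt_abs h, extendedUZero_of_one_lt_abs (by rwa [abs_neg]), abs_neg,
      neg_sq]

/-- The pairing of `Ũ₋₁` with Fourier transforms of Schwartz functions. The bounded function is
`k(ω) = sgn(ω) J₀(ω)`, written as `ω J₀(ω) / |ω|`. -/
theorem integral_extendedUNegOne_mul_schwartzFourier (φ : 𝓢(ℝ, ℂ)) :
    ∫ x, schwartzFourier φ x * (extendedUNegOne x : ℂ) = ∫ ω : ℝ, φ ω *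
      (Complex.I * (ω : ℂ) * (Real.pi : ℂ) * (besselJ 0 ω : ℂ) / ((|ω| : ℝ) : ℂ)) := by
  let k : ℝ → ℂ := fun ω => (ω : ℂ) * (besselJ 0 ω : ℂ) / ((|ω| : ℝ) : ℂ)
  have hpos : ∀ t : ℝ, 0 < t → k t = (besselJ 0 t : ℂ) := fun t ht => by
    have h0 : (t : ℂ) ≠ 0 := by exact_mod_cast ht.ne'
    simp only [k, abs_of_pos ht]
    field_simp
  have hneg : ∀ t : ℝ, 0 < t → k (-t) = -1 * (besselJ 0 t : ℂ) := fun t ht => by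
    have h0 : (t : ℂ) ≠ 0 := by exact_mod_cast ht.ne'
    simp only [k, abs_neg, abs_of_pos ht, besselJ_zero_neg]
    push_cast
    field_simp
  have hkC : ∀ ω, ‖k ω‖ ≤ 1 := by
    intro ω
    rcases lt_trichotomy ω 0 with h | rfl | h
    · have := hneg (-ω) (by linarith)
      rw [neg_neg] at this
      rw [this]
      simpa using abs_besselJ_zero_le (t := -ω) (by linarith)
    · simp [k]
    · rw [hpos ω h]
      simpa using abs_besselJ_zero_le h.le
  have hF := fun (ε : ℝ) (hε : 0 < ε) (x : ℝ) => fourierInt_exp_neg_abs_mul (continuous_besselJ 0)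
    (fun t => abs_besselJ_zero_le) hpos hneg hε x
  have hlim : ∀ᵐ x : ℝ, Tendsto
      (fun ε : ℝ => fourierInt (fun ω => (Real.exp (-ε * |ω|) : ℂ) * k ω) x)
      (𝓝[>] 0) (𝓝 (2 * Complex.I * extendedUNegOne x)) := by
    filter_upwards [ae_abs_ne_one] with x hx
    have hc : Tendsto (fun ε : ℝ => laplace (besselJ 0) ((ε : ℂ) + Complex.I * x) +
        -1 * laplace (besselJ 0) ((ε : ℂ) + Complex.I * ((-x : ℝ) : ℂ)))
        (𝓝[>] 0) (𝓝 (2 * Complex.I * extendedUNegOne x)) := by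
      rcases hx.lt_or_gt with h | h
      · have h1 := (tendsto_laplace_besselJ_zero_of_abs_lt h).add
          ((tendsto_laplace_besselJ_zero_of_abs_lt (x := -x) (by rwa [abs_neg])).const_mul (-1))
        convert h1 using 2
        simp [extendedUNegOne, h.le]
      · rcases lt_abs.mp h with h' | h'
        · have h1 := (tendsto_laplace_besselJ_zero_of_one_lt h').add
            ((tendsto_laplace_besselJ_zero_of_lt_neg_one (x := -x) (by linarith)).const_mul (-1))
          convert h1 using 2
          simp only [extendedUNegOne, h.not_ge, if_false, neg_sq,
            Real.sign_of_pos (zero_lt_one.trans h')]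
          push_cast
          ring
        · have h1 := (tendsto_laplace_besselJ_zero_of_lt_neg_one (x := x) (by linarith)).add
            ((tendsto_laplace_besselJ_zero_of_one_lt (x := -x) (by linarith)).const_mul (-1))
          convert h1 using 2
          simp only [extendedUNegOne, h.not_ge, if_false, neg_sq,
            Real.sign_of_neg (show x < 0 by linarith)]
          push_cast
          ring
    refine hc.congr' ?_
    filter_upwards [self_mem_nhdsWithin] with ε hε
    exact (hF ε hε x).2.symm
  have hB : ∀ ε : ℝ, 0 < ε → ε ≤ 1 → ∀ᵐ x : ℝ,
      ‖fourierInt (fun ω => (Real.exp (-ε * |ω|) : ℂ) * k ω) x‖ ≤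
        2 * (1 + (1 + |x|) * (1 + invSqrtSing (x - 1) + invSqrtSing (x + 1))) := by
    intro ε hε _
    filter_upwards [ae_abs_ne_one] with x hx
    rw [(hF ε hε x).2]
    refine (norm_add_le _ _).trans ?_
    rw [norm_mul, norm_neg, norm_one, one_mul]
    have h1 := norm_laplace_besselJ_zero_le_sing hε hx
    have h2 := norm_laplace_besselJ_zero_neg_le_sing hε hx
    have n1 := invSqrtSing_nonneg (x - 1)
    have n2 := invSqrtSing_nonneg (x + 1)
    nlinarith [mul_nonneg (abs_nonneg x) n1, mul_nonneg (abs_nonneg x) n2, abs_nonneg x]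
  have h := integral_mul_schwartzFourier_neg_of_tendsto hkC (fun ε hε => (hF ε hε 0).1) hlim hB φ
    (integrable_weight_mul_schwartz (schwartzFourier φ))
  rw [← integral_neg_eq_self] at h
  have hl : ∫ x, 2 * Complex.I * (extendedUNegOne (-x) : ℂ) * schwartzFourier φ (- -x) =
      -(2 * Complex.I) * ∫ x, schwartzFourier φ x * (extendedUNegOne x : ℂ) := by
    rw [← integral_const_mul]
    congr 1
    ext x
    rw [neg_neg, extendedUNegOne_neg]
    push_cast
    ring
  have hr : ∫ ω : ℝ, φ ω *
      (Complex.I * (ω : ℂ) * (Real.pi : ℂ) * (besselJ 0 ω : ℂ) / ((|ω| : ℝ) : ℂ)) =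
      Complex.I * Real.pi * ∫ ω, k ω * φ ω := by
    rw [← integral_const_mul]
    congr 1
    ext ω
    simp only [k]
    ring
  rw [hl] at h
  rw [hr]
  linear_combination (Complex.I / 2) * h +
    (∫ x, schwartzFourier φ x * (extendedUNegOne x : ℂ)) * Complex.I_sq

/-- The pairing of `Ũ₀` with Fourier transforms of Schwartz functions. The bounded function is
`k(ω) = J₁(|ω|)`. -/
theorem integral_extendedUZero_mul_schwartzFourier (φ : 𝓢(ℝ, ℂ)) :
    ∫ x, (extendedUZero x : ℂ) * schwartzFourier φ x =
      ∫ ω : ℝ, ((Real.pi * besselJ 1 |ω| : ℝ) : ℂ) * φ ω := by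
  let k : ℝ → ℂ := fun ω => (besselJ 1 |ω| : ℂ)
  have hpos : ∀ t : ℝ, 0 < t → k t = (besselJ 1 t : ℂ) := fun t ht => by
    simp only [k, abs_of_pos ht]
  have hneg : ∀ t : ℝ, 0 < t → k (-t) = 1 * (besselJ 1 t : ℂ) := fun t ht => by
    simp only [k, abs_neg, abs_of_pos ht, one_mul]
  have hkC : ∀ ω, ‖k ω‖ ≤ 1 := fun ω => by
    simpa [k] using abs_besselJ_one_le (abs_nonneg ω)
  have hF := fun (ε : ℝ) (hε : 0 < ε) (x : ℝ) => fourierInt_exp_neg_abs_mul (continuous_besselJ 1)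
    (fun t => abs_besselJ_one_le) hpos hneg hε x
  have hs : ∀ x : ℝ, Tendsto (fun ε : ℝ => (ε : ℂ) + Complex.I * x) (𝓝[>] 0)
      (𝓝 (Complex.I * x)) := fun x => by
    have h : Continuous fun ε : ℝ => (ε : ℂ) + Complex.I * x := by fun_prop
    simpa using (h.tendsto 0).mono_left (nhdsWithin_le_nhds (s := Set.Ioi 0))
  have hlim : ∀ᵐ x : ℝ, Tendsto
      (fun ε : ℝ => fourierInt (fun ω => (Real.exp (-ε * |ω|) : ℂ) * k ω) x)
      (𝓝[>] 0) (𝓝 (2 * extendedUZero x)) := by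
    filter_upwards [ae_abs_ne_one] with x hx
    have hc : Tendsto (fun ε : ℝ =>
        (1 - ((ε : ℂ) + Complex.I * x) * laplace (besselJ 0) ((ε : ℂ) + Complex.I * x)) +
        (1 - ((ε : ℂ) + Complex.I * ((-x : ℝ) : ℂ)) *
          laplace (besselJ 0) ((ε : ℂ) + Complex.I * ((-x : ℝ) : ℂ))))
        (𝓝[>] 0) (𝓝 (2 * extendedUZero x)) := by
      rcases hx.lt_or_gt with h | h
      · have h1 := (((hs x).mul (tendsto_laplace_besselJ_zero_of_abs_lt h)).const_sub 1).add
          (((hs (-x)).mul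
            (tendsto_laplace_besselJ_zero_of_abs_lt (x := -x) (by rwa [abs_neg]))).const_sub 1)
        convert h1 using 2
        rw [extendedUZero_of_abs_le h.le, neg_sq]
        push_cast
        ring
      · rcases lt_abs.mp h with h' | h'
        · have h1 := (((hs x).mul (tendsto_laplace_besselJ_zero_of_one_lt h')).const_sub 1).add
            (((hs (-x)).mul (tendsto_laplace_besselJ_zero_of_lt_neg_one (x := -x)
              (by linarith))).const_sub 1)
          convert h1 using 2
          rw [extendedUZero_of_one_lt_abs h, neg_sq, abs_of_pos (by linarith : 0 < x)]
          push_cast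
          linear_combination (-2 * x / (Real.sqrt (x ^ 2 - 1) : ℂ)) * Complex.I_sq
        · have h1 := (((hs x).mul (tendsto_laplace_besselJ_zero_of_lt_neg_one (x := x)
            (by linarith))).const_sub 1).add
            (((hs (-x)).mul (tendsto_laplace_besselJ_zero_of_one_lt (x := -x)
              (by linarith))).const_sub 1)
          convert h1 using 2
          rw [extendedUZero_of_one_lt_abs h, neg_sq, abs_of_neg (by linarith : x < 0)]
          push_cast
          linear_combination (2 * x / (Real.sqrt (x ^ 2 - 1) : ℂ)) * Complex.I_sq
    refine hc.congr' ?_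
    filter_upwards [self_mem_nhdsWithin] with ε hε
    rw [(hF ε hε x).2, one_mul, laplace_besselJ_one (by simpa using hε),
      laplace_besselJ_one (by simpa using hε)]
  have hB : ∀ ε : ℝ, 0 < ε → ε ≤ 1 → ∀ᵐ x : ℝ,
      ‖fourierInt (fun ω => (Real.exp (-ε * |ω|) : ℂ) * k ω) x‖ ≤
        2 * (1 + (1 + |x|) * (1 + invSqrtSing (x - 1) + invSqrtSing (x + 1))) := by
    intro ε hε hε1
    filter_upwards [ae_abs_ne_one] with x hx
    rw [(hF ε hε x).2, one_mul]
    refine (norm_add_le _ _).trans ?_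
    have h1 := norm_laplace_besselJ_one_le_of hε hε1 (norm_laplace_besselJ_zero_le_sing hε hx)
    have h2 := norm_laplace_besselJ_one_le_of hε hε1 (norm_laplace_besselJ_zero_neg_le_sing hε hx)
    rw [abs_neg] at h2
    linarith
  have h := integral_mul_schwartzFourier_neg_of_tendsto hkC (fun ε hε => (hF ε hε 0).1) hlim hB φ
    (integrable_weight_mul_schwartz (schwartzFourier φ))
  rw [← integral_neg_eq_self] at h
  have hl : ∫ x, 2 * (extendedUZero (-x) : ℂ) * schwartzFourier φ (- -x) =
      2 * ∫ x, (extendedUZero x : ℂ) * schwartzFourier φ x := by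
    rw [← integral_const_mul]
    congr 1
    ext x
    rw [neg_neg, extendedUZero_neg]
    ring
  have hr : ∫ ω : ℝ, ((Real.pi * besselJ 1 |ω| : ℝ) : ℂ) * φ ω = Real.pi * ∫ ω, k ω * φ ω := by
    rw [← integral_const_mul]
    congr 1
    ext ω
    simp only [k]
    push_cast
    ring
  rw [hl] at h
  rw [hr]
  linear_combination h / 2

/-- The Fourier transform of an integrable function is determined at every point by its action on
Schwartz functions, being continuous. -/
theorem fourierInt_eq_of_forall_schwartz {f F : ℝ → ℂ} (hf : Integrable f) (hF : Continuous F)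
    (h : ∀ φ : 𝓢(ℝ, ℂ), ∫ x, f x * schwartzFourier φ x = ∫ ω, F ω * φ ω) : fourierInt f = F := by
  have hc := continuous_fourierInt hf
  have hae : ∀ᵐ ω, fourierInt f ω - F ω = 0 := by
    refine ae_eq_zero_of_integral_contDiff_smul_eq_zero (hc.sub hF).locallyIntegrable ?_
    intro g hg hgc
    have h1 : HasCompactSupport (Complex.ofRealCLM ∘ g) := hgc.comp_left rfl
    have h2 : ContDiff ℝ (↑(⊤ : ℕ∞)) (Complex.ofRealCLM ∘ g) := by fun_prop
    let φ : 𝓢(ℝ, ℂ) := h1.toSchwartzMap h2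
    have hφ : ∀ ω, φ ω = (g ω : ℂ) := fun ω => rfl
    have h3 := integral_fourierInt_mul hf φ.integrable
    have h4 : ∀ x, fourierInt φ x = schwartzFourier φ x := fun x => (schwartzFourier_apply φ x).symm
    simp only [h4] at h3
    rw [h φ] at h3
    have hi : ∀ G : ℝ → ℂ, Continuous G → Integrable fun ω => G ω * φ ω := fun G hG =>
      (hG.mul φ.continuous).integrable_of_hasCompactSupport h1.mul_left
    have h5 := integral_sub (hi _ hc) (hi _ hF)
    rw [h3, sub_self] at h5
    rw [← h5]
    congr 1
    ext ω
    rw [hφ, Complex.real_smul]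
    ring
  have := (hc.sub hF).ae_eq_iff_eq volume continuous_const |>.mp hae
  ext ω
  exact sub_eq_zero.mp (congrFun this ω)

theorem mainTheorem11 :
    -- `Ũ₋₁` lies in `L^p` for `1 < p < 2`; its Fourier transform is a function in `L^q`
    (∀ (p q : ℝ≥0∞) [Fact (1 ≤ p)] [Fact (1 ≤ q)], 1 < p → p < 2 → p⁻¹ + q⁻¹ = 1 →
      ∃ (hU : MemLp (fun x : ℝ => (extendedUNegOne x : ℂ)) p volume)
        (hF : MemLp (fun ω : ℝ =>
          Complex.I * (ω : ℂ) * (Real.pi : ℂ) * (besselJ 0 ω : ℂ) / ((|ω| : ℝ) : ℂ)) q volume),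
        temperedFourier (Lp.toTemperedDistribution hU.toLp) =
          Lp.toTemperedDistribution hF.toLp) ∧
    -- `Ũ₀` lies in `L^1`; its Fourier transform is the classical integral, at every point
    Integrable (fun x : ℝ => (extendedUZero x : ℂ)) volume ∧
    (∀ ω : ℝ, fourierInt (fun x => (extendedUZero x : ℂ)) ω =
      ((Real.pi * besselJ 1 |ω| + 2 * Real.sinc ω - 2 * Real.sinc |ω| : ℝ) : ℂ)) := by
  refine ⟨fun p q _ _ hp1 hp2 hpq => ?_, integrable_extendedUZero, fun ω => ?_⟩
  · have hpt : p ≠ ∞ := (hp2.trans ENNReal.ofNat_lt_top).ne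
    have hqt : q ≠ ∞ := by
      rintro rfl
      rw [ENNReal.inv_top, add_zero, ENNReal.inv_eq_one] at hpq
      exact hp1.ne' hpq
    have hq2 : 2 < q := by
      by_contra! hq
      have h1 : (2 : ℝ≥0∞)⁻¹ < p⁻¹ := ENNReal.inv_lt_inv.mpr hp2
      have h2 : (2 : ℝ≥0∞)⁻¹ ≤ q⁻¹ := ENNReal.inv_le_inv.mpr hq
      have h3 := ENNReal.add_lt_add_of_lt_of_le (by simp) h1 h2
      rw [ENNReal.inv_two_add_inv_two, hpq] at h3
      exact lt_irrefl _ h3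
    refine ⟨memLp_extendedUNegOne hp1 hp2, memLp_mul_besselJ_zero_div_abs hq2 hqt, ?_⟩
    ext φ
    rw [temperedFourier_apply, Lp.toTemperedDistribution_apply, Lp.toTemperedDistribution_apply]
    calc _ = ∫ x, schwartzFourier φ x * (extendedUNegOne x : ℂ) := by
          refine integral_congr_ae ?_
          filter_upwards [(memLp_extendedUNegOne hp1 hp2).coeFn_toLp] with x hx
          rw [hx, smul_eq_mul]
      _ = _ := integral_extendedUNegOne_mul_schwartzFourier φ
      _ = _ := by
          refine integral_congr_ae ?_
          filter_upwards [(memLp_mul_besselJ_zero_div_abs hq2 hqt).coeFn_toLp] with x hx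
          rw [hx, smul_eq_mul]
  · have hc : Continuous fun ω : ℝ => ((Real.pi * besselJ 1 |ω| : ℝ) : ℂ) := by
      have := continuous_besselJ 1
      fun_prop
    have h := fourierInt_eq_of_forall_schwartz integrable_extendedUZero hc
      integral_extendedUZero_mul_schwartzFourier
    have hsinc : Real.sinc |ω| = Real.sinc ω := by
      rcases abs_choice ω with h' | h' <;> simp [h']
    rw [h, hsinc, add_sub_cancel_right]
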